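/- Let $n\ge 1$ be an integer, let $q\in\mathbb{C}[t]$ be a polynomial in one variable and let $c\in\mathbb{C}$. Write $\mathbb{C}[\underline{x}]=\mathbb{C}[x_1,\dots,x_n]$ and $\underline{x}^{[k]}=x_1^k\cdots x_n^k$ for $k\in\mathbb{N}$. Let $$P_q=\underline{x}^{[2]}y+z^2+\underline{x}^{[1]}q(z^2)\in\mathbb{C}[x_1,\dots,x_n,y,z],\qquad B_{q,c}=\mathbb{C}[x_1,\dots,x_n,y,z]/(P_q-c).$$ The derivation $$\Delta=\underline{x}^{[2]}\frac{\partial}{\partial z}-2z\bigl(1+\underline{x}^{[1]}q'(z^2)\bigr)\frac{\partial}{\partial y}$$ of $\mathbb{C}[x_1,\dots,x_n,y,z]$ annihilates $P_q-c$, and hence induces a derivation of $B_{q,c}$, again denoted by $\Delta$. A $\mathbb{C}$-derivation $\delta$ of a $\mathbb{C}$-algebra $B$ is called locally nilpotent if for every $b\in B$ there is an integer $m\ge 1$ with $\delta^m(b)=0$. Then $\Delta$ is a locally nilpotent derivation of $B_{q,c}$. Moreover, for every nonzero locally nilpotent derivation $\delta$ of $B_{q,c}$, writing $\mathbb{C}[\underline{x}]$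 also for its image in $B_{q,c}$ and $z$ for the class of $z$, the following hold. 1. $\ker(\delta)=\mathbb{C}[\underline{x}]$ and $\ker(\delta^2)=\mathbb{C}[\underline{x}]\,z+\mathbb{C}[\underline{x}]$. 2. There exists $h(\underline{x})\in\mathbb{C}[\underline{x}]$ such that $\delta=h(\underline{x})\Delta$. -/

import Mathlib

noncomputable section

open MvPolynomial

namespace LNDHypersurface

/-- The polynomial ring `ℂ[x₁, …, xₙ]`. -/
abbrev BaseRing (n : ℕ) : Type := MvPolynomial (Fin n) ℂ

/-- The polynomial ring `ℂ[x₁, …, xₙ, y, z]`; the variable `xᵢ` has index `Sum.inl i`,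
`y` has index `Sum.inr 0` and `z` has index `Sum.inr 1`. -/
abbrev AmbientRing (n : ℕ) : Type := MvPolynomial (Fin n ⊕ Fin 2) ℂ

/-- The variable `xᵢ` of `ℂ[x₁, …, xₙ, y, z]`. -/
def varX (n : ℕ) (i : Fin n) : AmbientRing n := X (Sum.inl i)

/-- The variable `y` of `ℂ[x₁, …, xₙ, y, z]`. -/
def varY (n : ℕ) : AmbientRing n := X (Sum.inr 0)

/-- The variable `z` of `ℂ[x₁, …, xₙ, y, z]`. -/
def varZ (n : ℕ) : AmbientRing n := X (Sum.inr 1)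

/-- The monomial `x^[k] = x₁ᵏ ⋯ xₙᵏ`. -/
def xPow (n k : ℕ) : AmbientRing n := ∏ i : Fin n, varX n i ^ k

/-- The polynomial `P_q = x^[2] y + z² + x^[1] q(z²)`. -/
def P (n : ℕ) (q : Polynomial ℂ) : AmbientRing n :=
  xPow n 2 * varY n + varZ n ^ 2 + xPow n 1 * Polynomial.aeval (varZ n ^ 2) q

/-- The principal ideal `(P_q - c)`. -/
def fiberIdeal (n : ℕ) (q : Polynomial ℂ) (c : ℂ) : Ideal (AmbientRing n) :=
  Ideal.span {P n q - C c}

/-- The coordinate ring `B_{q,c} = ℂ[x₁, …, xₙ, y, z] / (P_q - c)`. -/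
abbrev CoordRing (n : ℕ) (q : Polynomial ℂ) (c : ℂ) : Type :=
  AmbientRing n ⧸ fiberIdeal n q c

/-- The quotient map `ℂ[x₁, …, xₙ, y, z] → B_{q,c}`. -/
abbrev proj (n : ℕ) (q : Polynomial ℂ) (c : ℂ) : AmbientRing n →ₐ[ℂ] CoordRing n q c :=
  Ideal.Quotient.mkₐ ℂ (fiberIdeal n q c)

/-- The canonical map `ℂ[x₁, …, xₙ] → B_{q,c}`, sending `xᵢ` to the class of `xᵢ`. -/
def ofBase (n : ℕ) (q : Polynomial ℂ) (c : ℂ) : BaseRing n →ₐ[ℂ] CoordRing n q c :=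
  (proj n q c).comp (rename Sum.inl)

/-- The class of `z` in `B_{q,c}`. -/
def zClass (n : ℕ) (q : Polynomial ℂ) (c : ℂ) : CoordRing n q c :=
  proj n q c (varZ n)

/-- A derivation `δ` of a `ℂ`-algebra `B` is locally nilpotent if for every `b` there is
`m ≥ 1` with `δᵐ(b) = 0`. -/
def IsLocallyNilpotent {B : Type*} [CommRing B] [Algebra ℂ B] (δ : Derivation ℂ B B) : Prop :=
  ∀ b : B, ∃ m : ℕ, 1 ≤ m ∧ (⇑δ)^[m] b = 0

/-- The derivation `Δ = x^[2] ∂/∂z - 2 z (1 + x^[1] q'(z²)) ∂/∂y` of `ℂ[x₁, …, xₙ, y, z]`. -/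
def ambientDelta (n : ℕ) (q : Polynomial ℂ) :
    Derivation ℂ (AmbientRing n) (AmbientRing n) :=
  xPow n 2 • pderiv (Sum.inr 1) -
    (2 * varZ n * (1 + xPow n 1 * Polynomial.aeval (varZ n ^ 2) (Polynomial.derivative q))) •
      pderiv (Sum.inr 0)

theorem ambientDelta_varX (n : ℕ) (q : Polynomial ℂ) (i : Fin n) :
    ambientDelta n q (varX n i) = 0 := by
  simp [ambientDelta, varX, pderiv_X]

theorem ambientDelta_varY (n : ℕ) (q : Polynomial ℂ) :
    ambientDelta n q (varY n) = -(2 * varZ n *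
      (1 + xPow n 1 * Polynomial.aeval (varZ n ^ 2) (Polynomial.derivative q))) := by
  simp [ambientDelta, varY, pderiv_X]

theorem ambientDelta_varZ (n : ℕ) (q : Polynomial ℂ) :
    ambientDelta n q (varZ n) = xPow n 2 := by
  simp [ambientDelta, varZ, pderiv_X]

theorem ambientDelta_xPow (n : ℕ) (q : Polynomial ℂ) (k : ℕ) :
    ambientDelta n q (xPow n k) = 0 := by
  unfold xPow
  refine Finset.prod_induction _ (fun a => ambientDelta n q a = 0) ?_ (by simp) ?_
  · intro a b ha hb
    simp [Derivation.leibniz, ha, hb]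
  · intro i _
    simp [Derivation.leibniz_pow, ambientDelta_varX]

/-- `Δ` annihilates `P_q - c`. -/
theorem ambientDelta_P_sub (n : ℕ) (q : Polynomial ℂ) (c : ℂ) :
    ambientDelta n q (P n q - C c) = 0 := by
  have hq : ambientDelta n q (Polynomial.aeval (varZ n ^ 2) q) =
      Polynomial.aeval (varZ n ^ 2) (Polynomial.derivative q) * (2 * varZ n * xPow n 2) := by
    rw [Derivation.map_aeval, Derivation.leibniz_pow, ambientDelta_varZ]
    simp only [smul_eq_mul, nsmul_eq_mul, Nat.cast_ofNat, Nat.reduceSub, pow_one]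
    ring
  rw [map_sub, derivation_C, sub_zero, P, map_add, map_add, Derivation.leibniz,
    Derivation.leibniz, Derivation.leibniz_pow, hq, ambientDelta_xPow, ambientDelta_xPow,
    ambientDelta_varY, ambientDelta_varZ]
  simp only [smul_eq_mul, nsmul_eq_mul, Nat.cast_ofNat, Nat.reduceSub, pow_one]
  have h2 : xPow n 2 = xPow n 1 ^ 2 := by
    simp [xPow, Finset.prod_pow]
  rw [h2]
  ring

theorem proj_ambientDelta_eq_zero (n : ℕ) (q : Polynomial ℂ) (c : ℂ) (a : AmbientRing n)
    (ha : proj n q c a = 0) : proj n q c (ambientDelta n q a) = 0 := by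
  have ha' : a ∈ fiberIdeal n q c := Ideal.Quotient.eq_zero_iff_mem.mp ha
  obtain ⟨r, rfl⟩ := Ideal.mem_span_singleton'.mp ha'
  refine Ideal.Quotient.eq_zero_iff_mem.mpr ?_
  rw [Derivation.leibniz, ambientDelta_P_sub, smul_zero, zero_add, smul_eq_mul]
  exact Ideal.mul_mem_right _ _ (Ideal.mem_span_singleton_self _)

/-- The derivation of `B_{q,c}` induced by `Δ`. -/
def delta (n : ℕ) (q : Polynomial ℂ) (c : ℂ) :
    Derivation ℂ (CoordRing n q c) (CoordRing n q c) :=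
  Derivation.liftOfSurjective (f := proj n q c) (Ideal.Quotient.mkₐ_surjective ℂ _)
    (d := ambientDelta n q) (fun a ha => proj_ambientDelta_eq_zero n q c a ha)

/-- The defining property of the induced derivation. -/
theorem delta_proj (n : ℕ) (q : Polynomial ℂ) (c : ℂ) (a : AmbientRing n) :
    delta n q c (proj n q c a) = proj n q c (ambientDelta n q a) :=
  Derivation.liftOfSurjective_apply (Ideal.Quotient.mkₐ_surjective ℂ _)
    (proj_ambientDelta_eq_zero n q c) a

end LNDHypersurface

end

open LNDHypersurface

/-! On the locus where every `xᵢ` is invertible the equation can be solved for `y`, so `B_{q,c}`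
embeds in the Laurent polynomials in `x₁, …, xₙ, z` (`emb`). For a weight in which `x^[-2] z²`
dominates `y`, the monomials not divisible by `x^[2] y` have distinct leading exponents, so every
leading exponent of `B_{q,c}` lies in `leadSet` (`IsAdapted.exists_isLead`).

A derivation δ extends to the Laurent ring as `χᵐ ↦ χᵐ Λ(m)` with `Λ` additive (`emb_derivation`).
Its part at the dominant exponent `d` of `Λ` is homogeneous, `χᵐ ↦ l(m) χᵐ⁺ᵈ`. If δ is locally
nilpotent, `l` must vanish somewhere along each ray `s + ℕd` from the leading exponents `s` of the
generators, and integer arithmetic in `leadSet` then gives `dᵢ ≥ 2` for all `i`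
(`shift_of_locallyNilpotent`). Since the weight `weightX i` looks first at the order in `xᵢ`,
letting `i` vary makes `Λ` divisible by `x^[2]`. Hence `xᵢ` divides `δ(xᵢ)` in `B_{q,c}`, which
forces `δ(xᵢ) = 0`.

Now `δ = w · E` with `E = z ∂/∂z` and `w = Λ(expZ)`. Ordering by degree in `z` shows that `w` is
homogeneous of degree -1 in `z`, so `w = x^[2] z⁻¹ h(x)`, that is `δ = hΔ`. The kernels of δ and δ²
consist of the elements of `z`-degree 0, respectively at most 1; in that range `leadSet` allows no
negative power of any `xᵢ`. -/

noncomputable section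

open MvPolynomial

namespace LNDHypersurface

/-! ### Leading exponents and logarithmic derivations of group algebras -/

section Leading

variable {M Γ : Type*} [AddCommGroup M] [AddCommGroup Γ] [LinearOrder Γ]

/-- All exponents of `v` have weight less than `γ`. -/
def IsBelow (ν : M →+ Γ) (γ : Γ) (v : AddMonoidAlgebra ℂ M) : Prop :=
  ∀ m, v.coeff m ≠ 0 → ν m < γ

/-- `m` is the unique exponent of `v` of maximal weight. -/
def IsLead (ν : M →+ Γ) (v : AddMonoidAlgebra ℂ M) (m : M) : Prop :=
  v.coeff m ≠ 0 ∧ ∀ m', v.coeff m' ≠ 0 → m' ≠ m → ν m' < ν m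

variable {ν : M →+ Γ} {v w : AddMonoidAlgebra ℂ M} {m m' : M} {γ : Γ}

theorem IsBelow.add (hv : IsBelow ν γ v) (hw : IsBelow ν γ w) : IsBelow ν γ (v + w) := by
  intro m hm
  by_cases h : v.coeff m = 0
  · exact hw m (by simpa [h] using hm)
  · exact hv m h

theorem IsBelow.neg (hv : IsBelow ν γ v) : IsBelow ν γ (-v) :=
  fun m hm => hv m (by simpa using hm)

theorem IsBelow.sum {ι : Type*} (s : Finset ι) (f : ι → AddMonoidAlgebra ℂ M)
    (h : ∀ i ∈ s, IsBelow ν γ (f i)) : IsBelow ν γ (∑ i ∈ s, f i) :=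
  Finset.sum_induction f (IsBelow ν γ) (fun _ _ => IsBelow.add)
    (fun _ hm => absurd rfl hm) h

theorem isBelow_single {c : ℂ} (h : ν m < γ) : IsBelow ν γ (AddMonoidAlgebra.single m c) := by
  intro m' hm'
  by_cases e : m = m'
  · exact e ▸ h
  · simp [e] at hm'

theorem IsLead.unique (h : IsLead ν v m) (h' : IsLead ν v m') : m = m' := by
  by_contra hne
  exact lt_asymm (h.2 m' h'.1 (Ne.symm hne)) (h'.2 m h.1 hne)

theorem IsLead.le (h : IsLead ν v m) (h' : v.coeff m' ≠ 0) : ν m' ≤ ν m := by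
  by_cases e : m' = m
  · rw [e]
  · exact (h.2 m' h' e).le

theorem IsLead.ne_zero (h : IsLead ν v m) : v ≠ 0 := by
  rintro rfl
  exact h.1 rfl

theorem IsLead.add (h : IsLead ν v m) (hw : IsBelow ν (ν m) w) : IsLead ν (v + w) m := by
  have h0 : w.coeff m = 0 := by
    by_contra h0
    exact lt_irrefl _ (hw m h0)
  refine ⟨by simpa [h0] using h.1, fun m' hm' hne => ?_⟩
  by_cases e : v.coeff m' = 0
  · exact hw m' (by simpa [e] using hm')
  · exact h.2 m' e hne

theorem isLead_single {c : ℂ} (hc : c ≠ 0) : IsLead ν (AddMonoidAlgebra.single m c) m := by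
  refine ⟨by simpa using hc, fun m' hm' hne => ?_⟩
  simp [Ne.symm hne] at hm'

theorem exists_isLead_of_ne_zero (hν : Function.Injective ν) (hv : v ≠ 0) :
    ∃ m, IsLead ν v m := by
  have hne : v.coeff.support.Nonempty := by
    rw [Finsupp.support_nonempty_iff]
    exact fun h => hv (AddMonoidAlgebra.coeff_eq_zero.mp h)
  obtain ⟨m, hm, hmax⟩ := Finset.exists_max_image _ ν hne
  refine ⟨m, Finsupp.mem_support_iff.mp hm, fun m' hm' hne => ?_⟩
  exact lt_of_le_of_ne (hmax m' (Finsupp.mem_support_iff.mpr hm')) (fun h => hne (hν h))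

theorem exists_add_of_coeff_mul_ne_zero (h : (v * w).coeff m ≠ 0) :
    ∃ a b, v.coeff a ≠ 0 ∧ w.coeff b ≠ 0 ∧ a + b = m := by
  classical
  by_contra! hcon
  refine h ?_
  rw [AddMonoidAlgebra.coeff_mul]
  refine Finset.sum_eq_zero fun a ha => Finset.sum_eq_zero fun b hb => ?_
  exact if_neg (hcon a b (Finsupp.mem_support_iff.mp ha) (Finsupp.mem_support_iff.mp hb))

variable [IsOrderedAddMonoid Γ]

theorem IsLead.mul (h : IsLead ν v m) (h' : IsLead ν w m') : IsLead ν (v * w) (m + m') := by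
  classical
  have key : ∀ a b, v.coeff a ≠ 0 → w.coeff b ≠ 0 → (a ≠ m ∨ b ≠ m') →
      ν (a + b) < ν (m + m') := by
    intro a b ha hb hab
    rw [map_add, map_add]
    rcases hab with hab | hab
    · exact add_lt_add_of_lt_of_le (h.2 a ha hab) (h'.le hb)
    · exact add_lt_add_of_le_of_lt (h.le ha) (h'.2 b hb hab)
  constructor
  · have : (v * w).coeff (m + m') = v.coeff m * w.coeff m' := by
      refine AddMonoidAlgebra.coeff_mul_add_of_uniqueAdd ?_
      intro a b ha hb hab
      by_contra hcon
      have := key a b (Finsupp.mem_support_iff.mp ha) (Finsupp.mem_support_iff.mp hb)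
        (by tauto)
      rw [hab] at this
      exact lt_irrefl _ this
    rw [this]
    exact mul_ne_zero h.1 h'.1
  · intro e he hne
    obtain ⟨a, b, ha, hb, rfl⟩ := exists_add_of_coeff_mul_ne_zero he
    refine key a b ha hb ?_
    by_contra! hcon
    exact hne (by rw [hcon.1, hcon.2])

theorem IsLead.pow (h : IsLead ν v m) (k : ℕ) : IsLead ν (v ^ k) (k • m) := by
  induction k with
  | zero => simpa [AddMonoidAlgebra.one_def] using isLead_single (ν := ν) (m := 0) one_ne_zero
  | succ k ih => simpa [pow_succ, succ_nsmul] using ih.mul h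

/-- The linear endomorphism of a group algebra which multiplies each monomial `χᵐ` by `Λ m`. -/
def logDerivLinear (Λ : M →+ AddMonoidAlgebra ℂ M) :
    AddMonoidAlgebra ℂ M →ₗ[ℂ] AddMonoidAlgebra ℂ M :=
  (Finsupp.lsum ℂ fun m : M =>
    (LinearMap.mulRight ℂ (Λ m)).comp (AddMonoidAlgebra.lsingle m)).comp
      (AddMonoidAlgebra.coeffLinearEquiv ℂ).toLinearMap

theorem logDerivLinear_single (Λ : M →+ AddMonoidAlgebra ℂ M) (m : M) (c : ℂ) :
    logDerivLinear Λ (AddMonoidAlgebra.single m c) = AddMonoidAlgebra.single m c * Λ m := by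
  simp [logDerivLinear]

/-- The derivation of a group algebra which multiplies each monomial `χᵐ` by `Λ m`. -/
def logDeriv (Λ : M →+ AddMonoidAlgebra ℂ M) :
    Derivation ℂ (AddMonoidAlgebra ℂ M) (AddMonoidAlgebra ℂ M) :=
  Derivation.mk' (logDerivLinear Λ) <| by
    intro a b
    simp only [smul_eq_mul]
    induction a using AddMonoidAlgebra.induction_linear with
    | zero => simp
    | add f g hf hg =>
      rw [add_mul, map_add, hf, hg, map_add]
      ring
    | single m c =>
      induction b using AddMonoidAlgebra.induction_linear with
      | zero => simp
      | add f g hf hg =>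
        rw [mul_add, map_add, hf, hg, map_add]
        ring
      | single m' c' =>
        rw [AddMonoidAlgebra.single_mul_single, logDerivLinear_single, logDerivLinear_single,
          logDerivLinear_single, map_add, ← AddMonoidAlgebra.single_mul_single]
        ring

theorem logDeriv_single (Λ : M →+ AddMonoidAlgebra ℂ M) (m : M) (c : ℂ) :
    logDeriv Λ (AddMonoidAlgebra.single m c) = AddMonoidAlgebra.single m c * Λ m := by
  simp [logDeriv, logDerivLinear_single]

theorem logDeriv_eq_sum (Λ : M →+ AddMonoidAlgebra ℂ M) (v : AddMonoidAlgebra ℂ M) :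
    logDeriv Λ v = ∑ m ∈ v.coeff.support, AddMonoidAlgebra.single m (v.coeff m) * Λ m := by
  simp [logDeriv, logDerivLinear, Finsupp.sum]

/-- If `d` is the leading exponent of the derivation `logDeriv Λ`, then the leading exponent of a
Laurent polynomial is shifted by `d` unless the leading coefficient of the derivation vanishes. -/
theorem IsLead.logDeriv {Λ : M →+ AddMonoidAlgebra ℂ M} {d : M}
    (hd : ∀ m e, (Λ m).coeff e ≠ 0 → e ≠ d → ν e < ν d)
    (h : IsLead ν v m) (hm : (Λ m).coeff d ≠ 0) : IsLead ν (logDeriv Λ v) (m + d) := by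
  classical
  rw [logDeriv_eq_sum, ← Finset.add_sum_erase _ _ (Finsupp.mem_support_iff.mpr h.1)]
  refine IsLead.add ((isLead_single h.1).mul ⟨hm, hd m⟩) ?_
  refine IsBelow.sum _ _ fun m' hm' => ?_
  rw [Finset.mem_erase, Finsupp.mem_support_iff] at hm'
  have hlt := h.2 m' hm'.2 hm'.1
  intro e he
  obtain ⟨a, b, ha, hb, rfl⟩ := exists_add_of_coeff_mul_ne_zero he
  have : a = m' := by
    by_contra hne
    simp [Ne.symm hne] at ha
  subst this
  rw [map_add, map_add]
  refine add_lt_add_of_lt_of_le hlt ?_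
  by_cases hbd : b = d
  · rw [hbd]
  · exact (hd a b hb hbd).le

/-- Otherwise each application moves the leading exponent by `d`, and no iterate can vanish. -/
theorem IsLead.iterate_logDeriv {Λ : M →+ AddMonoidAlgebra ℂ M} {d : M}
    (hd : ∀ m e, (Λ m).coeff e ≠ 0 → e ≠ d → ν e < ν d) (h : IsLead ν v m)
    {k : ℕ} (hk : (LNDHypersurface.logDeriv Λ)^[k] v = 0) :
    ∃ j : ℕ, (Λ (m + j • d)).coeff d = 0 := by
  by_contra! hcon
  have : ∀ k : ℕ, IsLead ν ((LNDHypersurface.logDeriv Λ)^[k] v) (m + k • d) := by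
    intro k
    induction k with
    | zero => simpa using h
    | succ k ih =>
      rw [Function.iterate_succ_apply', succ_nsmul, ← add_assoc]
      exact ih.logDeriv hd (hcon k)
  exact (this k).ne_zero hk

end Leading

/-! ### Laurent exponents and the combinatorial core -/

section

/-- Exponents of Laurent monomials in `x₁, …, xₙ, z`. -/
abbrev Expo (n : ℕ) : Type := (Fin n → ℤ) × ℤ

/-- The Laurent polynomial ring in `x₁, …, xₙ, z`. -/
abbrev Laurent (n : ℕ) : Type := AddMonoidAlgebra ℂ (Expo n)

/-- The exponent of `xᵢ`. -/
def expX {n : ℕ} (i : Fin n) : Expo n := (Pi.single i 1, 0)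

/-- The exponent of `z`. -/
def expZ {n : ℕ} : Expo n := (0, 1)

/-- The exponent of `x₁ ⋯ xₙ`. -/
def expU {n : ℕ} : Expo n := (1, 0)

/-- The exponent of `x^[-2] z²`. -/
def expY {n : ℕ} : Expo n := (-2, 2)

/-- The Laurent monomial with a given exponent. -/
def mono {n : ℕ} (m : Expo n) : Laurent n := AddMonoidAlgebra.single m 1

variable {n : ℕ}

theorem expo_eq_sum (m : Expo n) : m = ∑ i, m.1 i • expX i + m.2 • expZ := by
  refine Prod.ext ?_ ?_
  · funext j
    simp [expX, expZ, Prod.fst_sum, Finset.sum_apply, Pi.single_apply]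
  · simp [expX, expZ, Prod.snd_sum]

theorem addMonoidHom_eq_sum {G : Type*} [AddCommGroup G] (f : Expo n →+ G) (m : Expo n) :
    f m = ∑ i, m.1 i • f (expX i) + m.2 • f expZ := by
  conv_lhs => rw [expo_eq_sum m]
  simp only [map_add, map_sum, map_zsmul]

theorem expU_eq_sum : (expU : Expo n) = ∑ i, expX i := by
  rw [expo_eq_sum expU]
  simp [expU]

theorem mono_add (m m' : Expo n) : mono (m + m') = mono m * mono m' := by
  simp [mono, AddMonoidAlgebra.single_mul_single]

theorem mono_zero : mono (0 : Expo n) = 1 := rfl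

theorem mono_nsmul (k : ℕ) (m : Expo n) : mono (k • m) = mono m ^ k := by
  simp [mono, AddMonoidAlgebra.single_pow]

theorem mono_sum {ι : Type*} (s : Finset ι) (f : ι → Expo n) :
    mono (∑ i ∈ s, f i) = ∏ i ∈ s, mono (f i) := by
  simp [mono, AddMonoidAlgebra.prod_single]

theorem mono_neg_mul (m : Expo n) : mono (-m) * mono m = 1 := by
  rw [← mono_add, neg_add_cancel, mono_zero]

theorem mono_mul_neg (m : Expo n) : mono m * mono (-m) = 1 := by
  rw [← mono_add, add_neg_cancel, mono_zero]

theorem mono_ne_zero (m : Expo n) : mono m ≠ 0 := by simp [mono]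

theorem coeff_mono_mul (m e : Expo n) (v : Laurent n) :
    (mono m * v).coeff e = v.coeff (-m + e) := by
  rw [mono, AddMonoidAlgebra.coeff_single_mul_apply, one_mul]

/-- The exponents which occur as leading exponents of the elements of `B_{q,c}`. -/
def leadSet (n : ℕ) : Set (Expo n) := {m | 0 ≤ m.2 ∧ ∀ i, -2 * (m.2 / 2) ≤ m.1 i}

/-- The combinatorial core: a homogeneous locally nilpotent derivation `χᵐ ↦ l(m) χᵐ⁺ᵈ` preserving
the semigroup `leadSet n` lowers the exponent of `z` by one and increases that of each `xᵢ` by at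
least two. -/
theorem shift_of_locallyNilpotent (l : Expo n →+ ℂ) (hl : l ≠ 0) (d : Expo n)
    (shift : ∀ s, ((∃ i, s = expX i) ∨ s = expZ ∨ s = expY) → l s ≠ 0 → s + d ∈ leadSet n)
    (nil : ∀ s, ((∃ i, s = expX i) ∨ s = expZ ∨ s = expY) → ∃ k : ℕ, l (s + k • d) = 0) :
    ∀ i, 2 ≤ d.1 i := by
  -- If `l d = 0`, then `l` is constant on each ray `s + ℕd`, so it vanishes at every generator.
  have hld : l d ≠ 0 := by
    intro hld
    refine hl (AddMonoidHom.ext fun m => ?_)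
    have h : ∀ s, ((∃ i, s = expX i) ∨ s = expZ ∨ s = expY) → l s = 0 := by
      intro s hs
      obtain ⟨k, hk⟩ := nil s hs
      rwa [map_add, map_nsmul, hld, smul_zero, add_zero] at hk
    rw [addMonoidHom_eq_sum]
    simp [h _ (Or.inl ⟨_, rfl⟩), h _ (Or.inr (Or.inl rfl))]
  -- The normalised form `-l / l d` takes natural values `aᵢ`, `t`, `y` on the generators and -1 at
  -- `d`.
  have nil' : ∀ s, ((∃ i, s = expX i) ∨ s = expZ ∨ s = expY) →
      ∃ k : ℕ, l s = -(k * l d) := by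
    intro s hs
    obtain ⟨k, hk⟩ := nil s hs
    refine ⟨k, ?_⟩
    rw [map_add, map_nsmul, nsmul_eq_mul] at hk
    linear_combination hk
  choose a ha using fun i => nil' (expX i) (Or.inl ⟨i, rfl⟩)
  obtain ⟨t, ht⟩ := nil' expZ (Or.inr (Or.inl rfl))
  obtain ⟨y, hy⟩ := nil' expY (Or.inr (Or.inr rfl))
  have hform : ∀ m : Expo n, l m = -(((∑ i, m.1 i * (a i : ℤ) + m.2 * t : ℤ) : ℂ) * l d) := by
    intro m
    rw [addMonoidHom_eq_sum, ht]
    simp only [ha, zsmul_eq_mul]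
    push_cast
    rw [add_mul, Finset.sum_mul, neg_add, ← Finset.sum_neg_distrib]
    congr 1
    · exact Finset.sum_congr rfl fun i _ => by ring
    · ring
  have hd1 : ∑ i, d.1 i * (a i : ℤ) + d.2 * t = -1 := by
    have h := hform d
    have h' : ((∑ i, d.1 i * (a i : ℤ) + d.2 * t : ℤ) : ℂ) = ((-1 : ℤ) : ℂ) := by
      refine mul_right_cancel₀ hld ?_
      push_cast at h ⊢
      linear_combination h
    exact_mod_cast h'
  -- As `y ≥ 0`, this relation yields `t ≥ ∑ aᵢ`.
  have hy2 : (y : ℤ) = 2 * t - 2 * ∑ i, (a i : ℤ) := by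
    have h := hform expY
    rw [hy] at h
    have h' : ((y : ℤ) : ℂ) =
        ((∑ i, (expY : Expo n).1 i * (a i : ℤ) + (expY : Expo n).2 * t : ℤ) : ℂ) := by
      refine mul_right_cancel₀ hld ?_
      push_cast at h ⊢
      linear_combination -h
    have h'' := Int.cast_injective h'
    rw [h'']
    simp only [expY, Pi.neg_apply, Pi.ofNat_apply, ← Finset.mul_sum]
    ring
  have hx : ∀ j, a j ≠ 0 → expX j + d ∈ leadSet n := by
    intro j hj
    refine shift _ (Or.inl ⟨j, rfl⟩) ?_
    rw [ha]
    exact neg_ne_zero.mpr (mul_ne_zero (Nat.cast_ne_zero.mpr hj) hld)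
  have hz : t ≠ 0 → expZ + d ∈ leadSet n := by
    intro hj
    refine shift _ (Or.inr (Or.inl rfl)) ?_
    rw [ht]
    exact neg_ne_zero.mpr (mul_ne_zero (Nat.cast_ne_zero.mpr hj) hld)
  have hyy : y ≠ 0 → expY + d ∈ leadSet n := by
    intro hj
    refine shift _ (Or.inr (Or.inr rfl)) ?_
    rw [hy]
    exact neg_ne_zero.mpr (mul_ne_zero (Nat.cast_ne_zero.mpr hj) hld)
  -- If `f = d.2 ≥ 0`, some `j` has `a j > 0` and `d.1 j < -f`. Membership of `expX j + d` in
  -- `leadSet` then leaves only `f` even and `d.1 j = -f - 1`, which is excluded by `expZ + d` when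
  -- `y = 0` and by `expY + d` when `y ≠ 0`.
  have hf : d.2 < 0 := by
    by_contra! hf
    have hrw : ∑ i, (a i : ℤ) * (d.1 i + d.2) + (t - ∑ i, (a i : ℤ)) * d.2 = -1 := by
      rw [← hd1]
      simp only [mul_add, Finset.sum_add_distrib, ← Finset.sum_mul]
      rw [Finset.sum_congr rfl fun i _ => mul_comm (a i : ℤ) (d.1 i)]
      ring
    have hpos : 0 ≤ (t - ∑ i, (a i : ℤ)) * d.2 := mul_nonneg (by omega) hf
    obtain ⟨j, -, hj⟩ : ∃ j ∈ Finset.univ, (a j : ℤ) * (d.1 j + d.2) < 0 := by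
      by_contra! hcon
      have := Finset.sum_nonneg hcon
      omega
    have haj : a j ≠ 0 := by
      rintro h
      simp [h] at hj
    have hneg : d.1 j + d.2 < 0 := by
      by_contra! h
      exact absurd (mul_nonneg (Int.natCast_nonneg (a j)) h) (not_le.mpr hj)
    have h1 := (hx j haj).2 j
    simp only [expX, Prod.fst_add, Prod.snd_add, Pi.add_apply, Pi.single_eq_same, zero_add] at h1
    by_cases hy0 : y = 0
    · have hle : (a j : ℤ) ≤ ∑ i, (a i : ℤ) :=
        Finset.single_le_sum (f := fun i => (a i : ℤ)) (fun i _ => Int.natCast_nonneg _)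
          (Finset.mem_univ j)
      have h2 := (hz (by omega)).2 j
      simp only [expZ, Prod.fst_add, Prod.snd_add, Pi.add_apply, Pi.zero_apply, zero_add] at h2
      omega
    · have h2 := (hyy hy0).2 j
      simp only [expY, Prod.fst_add, Prod.snd_add, Pi.add_apply, Pi.neg_apply,
        Pi.ofNat_apply] at h2
      omega
  -- A nonzero `a j` would put `expX j + d`, whose `z`-exponent is negative, in `leadSet`.
  have ha0 : ∀ j, a j = 0 := by
    intro j
    by_contra hj
    have := (hx j hj).1
    simp only [expX, Prod.snd_add, zero_add] at this
    omega
  simp only [ha0, Nat.cast_zero, mul_zero, Finset.sum_const_zero, zero_add, sub_zero] at hd1 hy2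
  have ht0 : t ≠ 0 := by
    rintro rfl
    simp at hd1
  have h1 := (hz ht0).1
  simp only [expZ, Prod.snd_add] at h1
  have hd2 : d.2 = -1 := by omega
  intro j
  -- Here `y = 2t ≠ 0`, and `expY + d` has `z`-exponent 1, so its `x`-exponents `d.1 j - 2` are
  -- nonnegative.
  have h2 := (hyy (by omega)).2 j
  simp only [expY, Prod.fst_add, Prod.snd_add, Pi.add_apply, Pi.neg_apply,
    Pi.ofNat_apply, hd2] at h2
  omega

/-! ### Weights on the exponents -/

/-- The weights for which `x^[-2] z²` is the leading term of `y`. -/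
structure IsAdapted {Γ : Type*} [AddCommGroup Γ] [LinearOrder Γ] (ν : Expo n →+ Γ) : Prop where
  injective : Function.Injective ν
  pos : 0 < ν expZ
  lt : ∀ k : ℕ, k • ν expZ < ν (-expU)

/-- The lexicographic weight comparing first `-aᵢ`, then `b`, then all the `aⱼ`. -/
def weightX (i : Fin n) : Expo n →+ ℤ ×ₗ (ℤ ×ₗ Lex (Fin n → ℤ)) where
  toFun m := toLex (-m.1 i, toLex (m.2, toLex m.1))
  map_zero' := by simp
  map_add' a b := by
    rw [Prod.fst_add, Pi.add_apply, neg_add]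
    rfl

/-- The lexicographic weight comparing first `b`, then all the `aⱼ`. -/
def weightZ : Expo n →+ ℤ ×ₗ Lex (Fin n → ℤ) where
  toFun m := toLex (m.2, toLex m.1)
  map_zero' := rfl
  map_add' _ _ := rfl

theorem weightX_le {i : Fin n} {m m' : Expo n} (h : weightX i m ≤ weightX i m') :
    m'.1 i ≤ m.1 i := by
  rcases Prod.Lex.toLex_le_toLex.mp h with h | h
  · simpa using h.le
  · simpa using h.1.le

theorem weightZ_le {m m' : Expo n} (h : weightZ m ≤ weightZ m') : m.2 ≤ m'.2 := by
  rcases Prod.Lex.toLex_le_toLex.mp h with h | h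
  · simpa using h.le
  · simpa using h.1.le

theorem weightZ_injective : Function.Injective (weightZ (n := n)) := by
  intro a b h
  have h' := toLex.injective h
  exact Prod.ext (toLex.injective (congrArg Prod.snd h')) (congrArg Prod.fst h')

theorem weightX_isAdapted (i : Fin n) : IsAdapted (weightX i) where
  injective a b h := weightZ_injective (congrArg Prod.snd (toLex.injective h))
  pos := by
    refine Prod.Lex.toLex_lt_toLex.mpr (Or.inr ⟨by simp [expZ], ?_⟩)
    exact Prod.Lex.toLex_lt_toLex.mpr (Or.inl (by simp [expZ]))
  lt k := by
    rw [← map_nsmul]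
    exact Prod.Lex.toLex_lt_toLex.mpr (Or.inl (by simp [expZ, expU]))

end

/-! ### The embedding into Laurent polynomials -/

section

variable {n : ℕ}

theorem expY_eq : (expY : Expo n) = -(2 • expU) + 2 • expZ := by
  refine Prod.ext ?_ ?_
  · funext i
    simp [expY, expU, expZ]
  · simp [expY, expU, expZ]

/-- The expression of `y` as a Laurent polynomial in `x₁, …, xₙ, z`. -/
def laurentY (n : ℕ) (q : Polynomial ℂ) (c : ℂ) : Laurent n :=
  mono (-(2 • expU)) * (algebraMap ℂ (Laurent n) c - mono expZ ^ 2 -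
    mono expU * Polynomial.aeval (mono expZ ^ 2) q)

theorem laurentY_eq (q : Polynomial ℂ) (c : ℂ) :
    laurentY n q c = -mono expY + (c • mono (-(2 • expU)) -
      ∑ j ∈ Finset.range (q.natDegree + 1), q.coeff j • mono (-expU + (2 * j) • expZ)) := by
  have h1 : (mono expY : Laurent n) = mono (-(2 • expU)) * mono expZ ^ 2 := by
    rw [expY_eq, mono_add, mono_nsmul]
  have h2 : (mono (-expU) : Laurent n) = mono (-(2 • expU)) * mono expU := by
    rw [← mono_add]
    congr 1
  have h3 : ∑ j ∈ Finset.range (q.natDegree + 1), q.coeff j • mono (-expU + (2 * j) • expZ) =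
      mono (-(2 • expU)) * mono expU * Polynomial.aeval (mono expZ ^ 2 : Laurent n) q := by
    rw [Polynomial.aeval_eq_sum_range, Finset.mul_sum]
    refine Finset.sum_congr rfl fun j _ => ?_
    rw [mono_add, mono_nsmul, h2, pow_mul, mul_smul_comm]
  rw [h1, h3, laurentY, Algebra.smul_def c]
  ring

section Weight

variable {Γ : Type*} [AddCommGroup Γ] [LinearOrder Γ] {ν : Expo n →+ Γ}

theorem isBelow_smul_mono {γ : Γ} {m : Expo n} (h : ν m < γ) (a : ℂ) :
    IsBelow ν γ (a • mono m) := by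
  rw [mono, AddMonoidAlgebra.smul_single]
  exact isBelow_single h

theorem isLead_mono (ν : Expo n →+ Γ) (m : Expo n) : IsLead ν (mono m) m :=
  isLead_single one_ne_zero

/-- The terms `x^[-1] z^(2j)` lie below `x^[-2] z²` whatever the degree of `q`, because `x^[-1]`
outweighs every power of `z`; the constant term lies below because `z` has positive weight. -/
theorem IsAdapted.isLead_laurentY [IsOrderedAddMonoid Γ] (hν : IsAdapted ν) (q : Polynomial ℂ) (c : ℂ) :
    IsLead ν (laurentY n q c) expY := by
  have hY : ν expY = ν (-expU) + ν (-expU) + 2 • ν expZ := by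
    rw [expY_eq, map_add, map_nsmul, map_neg, map_neg, map_nsmul]
    abel
  have h0 : 0 < 2 • ν expZ := nsmul_pos hν.pos two_ne_zero
  rw [laurentY_eq, sub_eq_add_neg]
  refine IsLead.add ?_ (IsBelow.add ?_ (IsBelow.neg (IsBelow.sum _ _ fun j _ => ?_)))
  · rw [mono, ← AddMonoidAlgebra.single_neg]
    exact isLead_single (neg_ne_zero.mpr one_ne_zero)
  · refine isBelow_smul_mono ?_ c
    rw [expY_eq, map_add, map_nsmul]
    exact lt_add_of_pos_right _ h0
  · refine isBelow_smul_mono ?_ _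
    rw [hY, map_add, map_nsmul, add_assoc]
    exact add_lt_add_right ((hν.lt _).trans (lt_add_of_pos_right _ h0)) _

end Weight

/-- The homomorphism `ℂ[x₁, …, xₙ, y, z] → ℂ[x₁^±, …, xₙ^±, z^±]` with kernel `(P_q - c)`. -/
def toLaurent (n : ℕ) (q : Polynomial ℂ) (c : ℂ) : AmbientRing n →ₐ[ℂ] Laurent n :=
  aeval (Sum.elim (fun i => mono (expX i)) ![laurentY n q c, mono expZ])

variable (q : Polynomial ℂ) (c : ℂ)

@[simp]
theorem toLaurent_varX (i : Fin n) : toLaurent n q c (varX n i) = mono (expX i) := by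
  simp [toLaurent, varX]

@[simp]
theorem toLaurent_varY : toLaurent n q c (varY n) = laurentY n q c := by
  simp [toLaurent, varY]

@[simp]
theorem toLaurent_varZ : toLaurent n q c (varZ n) = mono expZ := by
  simp [toLaurent, varZ]

@[simp]
theorem toLaurent_xPow (k : ℕ) : toLaurent n q c (xPow n k) = mono (k • expU) := by
  rw [xPow, map_prod, expU_eq_sum, Finset.smul_sum, mono_sum]
  refine Finset.prod_congr rfl fun i _ => ?_
  rw [mono_nsmul, map_pow, toLaurent_varX]

theorem toLaurent_P_sub : toLaurent n q c (P n q - C c) = 0 := by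
  have hC : toLaurent n q c (C c) = algebraMap ℂ (Laurent n) c :=
    (toLaurent n q c).commutes c
  have h := mono_mul_neg (n := n) (2 • expU)
  rw [map_sub, P, map_add, map_add, map_mul, map_mul, hC, ← Polynomial.aeval_algHom_apply]
  simp only [map_pow, toLaurent_varY, toLaurent_varZ, toLaurent_xPow, laurentY, one_smul]
  linear_combination (algebraMap ℂ (Laurent n) c - mono expZ ^ 2 -
    mono expU * Polynomial.aeval (mono expZ ^ 2) q) * h

/-! ### Normal forms and their leading exponents -/

/-- The leading exponent of the image of a monomial of `ℂ[x₁, …, xₙ, y, z]`. -/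
def leadExpo (m : Fin n ⊕ Fin 2 →₀ ℕ) : Expo n :=
  (fun i => m (Sum.inl i) - 2 * m (Sum.inr 0), m (Sum.inr 1) + 2 * m (Sum.inr 0))

theorem leadExpo_eq (m : Fin n ⊕ Fin 2 →₀ ℕ) :
    leadExpo m = ∑ i, m (Sum.inl i) • expX i +
      (m (Sum.inr 0) • expY + m (Sum.inr 1) • expZ) := by
  refine Prod.ext ?_ ?_
  · funext i
    simp [leadExpo, expX, expY, expZ, Prod.fst_sum, Finset.sum_apply, Pi.single_apply]
    ring
  · simp [leadExpo, expX, expY, expZ, Prod.snd_sum]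
    ring

theorem toLaurent_monomial (m : Fin n ⊕ Fin 2 →₀ ℕ) (a : ℂ) :
    toLaurent n q c (monomial m a) = a • (mono (∑ i, m (Sum.inl i) • expX i) *
      (laurentY n q c ^ m (Sum.inr 0) * mono (m (Sum.inr 1) • expZ))) := by
  rw [toLaurent, aeval_monomial, Finsupp.prod_fintype _ _ (fun _ => pow_zero _),
    Fintype.prod_sum_type, Fin.prod_univ_two, Algebra.smul_def, mono_sum]
  simp only [mono_nsmul]
  simp

theorem IsAdapted.isLead_toLaurent_monomial {Γ : Type*} [AddCommGroup Γ] [LinearOrder Γ]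
    [IsOrderedAddMonoid Γ] {ν : Expo n →+ Γ} (hν : IsAdapted ν) (m : Fin n ⊕ Fin 2 →₀ ℕ) {a : ℂ}
    (ha : a ≠ 0) : IsLead ν (toLaurent n q c (monomial m a)) (leadExpo m) := by
  have h : IsLead ν (toLaurent n q c (monomial m 1)) (leadExpo m) := by
    rw [toLaurent_monomial, one_smul, leadExpo_eq]
    exact (isLead_mono ν _).mul (((hν.isLead_laurentY q c).pow _).mul (isLead_mono ν _))
  rw [show monomial m a = a • monomial m (1 : ℂ) by simp [smul_monomial], map_smul]
  exact ⟨by simpa [ha] using h.1, fun m' hm' => h.2 m' (by simpa [ha] using hm')⟩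

/-- The exponents of the monomials not divisible by `x^[2] y`. -/
def normalExponents (n : ℕ) : Set (Fin n ⊕ Fin 2 →₀ ℕ) :=
  {m | m (Sum.inr 0) = 0 ∨ ∃ i, m (Sum.inl i) < 2}

/-- At a fixed leading exponent, a larger `y`-exponent requires every `xᵢ`-exponent to be at least
2, hence divisibility by `x^[2] y`. So the `y`-exponent is determined, and with it all the others.
-/
theorem leadExpo_injOn : Set.InjOn leadExpo (normalExponents n) := by
  have key : ∀ m ∈ normalExponents n, ∀ m', leadExpo m' = leadExpo m →
      m (Sum.inr 0) ≤ m' (Sum.inr 0) := by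
    intro m hm m' h
    by_contra! hlt
    rcases hm with hm | ⟨i, hi⟩
    · omega
    · have := congrFun (congrArg Prod.fst h) i
      simp only [leadExpo] at this
      omega
  intro m hm m' hm' h
  have h0 : m (Sum.inr 0) = m' (Sum.inr 0) :=
    le_antisymm (key m hm m' h.symm) (key m' hm' m h)
  ext x
  rcases x with i | j
  · have := congrFun (congrArg Prod.fst h) i
    simp only [leadExpo] at this
    omega
  · fin_cases j
    · exact h0
    · have := congrArg Prod.snd h
      simp only [leadExpo] at this
      change m (Sum.inr 1) = m' (Sum.inr 1)
      omega

theorem leadExpo_mem_leadSet {m : Fin n ⊕ Fin 2 →₀ ℕ} :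
    leadExpo m ∈ leadSet n := by
  refine ⟨by simp only [leadExpo]; positivity, fun i => ?_⟩
  simp only [leadExpo]
  omega

/-- Modulo `P_q - c`, every polynomial is a combination of monomials not divisible by
`x^[2] y`. -/
theorem exists_normalForm (f : AmbientRing n) :
    ∃ g ∈ restrictSupport ℂ (normalExponents n), proj n q c g = proj n q c f := by
  classical
  have reduce : proj n q c (xPow n 2 * varY n) =
      proj n q c (C c - varZ n ^ 2 - xPow n 1 * Polynomial.aeval (varZ n ^ 2) q) := by
    rw [← sub_eq_zero, ← map_sub]
    refine Ideal.Quotient.eq_zero_iff_mem.mpr ?_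
    have h : xPow n 2 * varY n -
        (C c - varZ n ^ 2 - xPow n 1 * Polynomial.aeval (varZ n ^ 2) q) = P n q - C c := by
      rw [P]
      ring
    rw [h]
    exact Ideal.mem_span_singleton_self _
  set r := C c - varZ n ^ 2 - xPow n 1 * Polynomial.aeval (varZ n ^ 2) q with hr
  -- The replacement `r` of `x^[2] y` is free of `y`, so each reduction lowers the `y`-degree and
  -- the induction terminates.
  have hdeg : degreeOf (Sum.inr 0) r = 0 := by
    have hX : ∀ x : Fin n ⊕ Fin 2, x ≠ Sum.inr 0 →
        X x ∈ supported ℂ ({Sum.inr 0}ᶜ : Set (Fin n ⊕ Fin 2)) :=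
      fun x hx => X_mem_supported.mpr hx
    have hz : varZ n ∈ supported ℂ ({Sum.inr 0}ᶜ : Set (Fin n ⊕ Fin 2)) :=
      hX _ (by simp)
    have hmem : r ∈ supported ℂ ({Sum.inr 0}ᶜ : Set (Fin n ⊕ Fin 2)) := by
      rw [hr, Polynomial.aeval_eq_sum_range]
      refine sub_mem (sub_mem (Subalgebra.algebraMap_mem _ c) (pow_mem hz 2)) (mul_mem ?_ ?_)
      · exact prod_mem fun i _ => pow_mem (hX _ (by simp)) 1
      · exact sum_mem fun j _ => Subalgebra.smul_mem _ (pow_mem (pow_mem hz 2) j) _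
    by_contra h
    exact mem_supported.mp hmem (mem_vars_iff_degreeOf_ne_zero.mpr h) rfl
  let t : Fin n ⊕ Fin 2 →₀ ℕ := Finsupp.equivFunOnFinite.symm (Sum.elim (fun _ => 2) ![1, 0])
  have ht : monomial t (1 : ℂ) = xPow n 2 * varY n := by
    rw [monomial_eq, C_1, one_mul, Finsupp.prod_fintype _ _ (fun _ => pow_zero _),
      Fintype.prod_sum_type, Fin.prod_univ_two]
    simp [t, xPow, varX, varY]
  let K := (restrictSupport ℂ (normalExponents n)).map (proj n q c).toLinearMap
  suffices H : ∀ k : ℕ, ∀ f : AmbientRing n, degreeOf (Sum.inr 0) f ≤ k → proj n q c f ∈ K from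
    H _ f le_rfl
  intro k
  induction k with
  | zero =>
    intro f hf
    refine ⟨f, fun m hm => Or.inl ?_, rfl⟩
    exact Nat.le_zero.mp ((monomial_le_degreeOf _ hm).trans hf)
  | succ k ih =>
    intro f hf
    rw [f.as_sum, map_sum]
    refine sum_mem fun m hm => ?_
    by_cases hN : m ∈ normalExponents n
    · exact ⟨_, (monomial_mem_restrictSupport _).mpr (Or.inl hN), rfl⟩
    · obtain ⟨h0, h2⟩ := not_or.mp hN
      have hle : t ≤ m := by
        intro x
        rcases x with i | j
        · exact not_lt.mp (fun h => h2 ⟨i, h⟩)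
        · fin_cases j
          · exact Nat.one_le_iff_ne_zero.mpr h0
          · exact Nat.zero_le _
      have hm' : monomial m (coeff m f) = monomial (m - t) (coeff m f) * monomial t 1 := by
        rw [monomial_mul, mul_one, tsub_add_cancel_of_le hle]
      rw [hm', map_mul, ht, reduce, ← map_mul]
      refine ih _ ((degreeOf_mul_le _ _ _).trans ?_)
      rw [hdeg, add_zero]
      by_cases hc : coeff m f = 0
      · simp [hc]
      rw [degreeOf_monomial_eq _ _ hc]
      have := (monomial_le_degreeOf (Sum.inr 0) hm).trans hf
      have ht0 : t (Sum.inr 0) = 1 := rfl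
      rw [Finsupp.tsub_apply, ht0]
      omega

/-- The embedding of `B_{q,c}` into a Laurent polynomial ring. -/
def emb (n : ℕ) (q : Polynomial ℂ) (c : ℂ) : CoordRing n q c →ₐ[ℂ] Laurent n :=
  Ideal.Quotient.liftₐ (fiberIdeal n q c) (toLaurent n q c) fun a ha => by
    obtain ⟨r, rfl⟩ := Ideal.mem_span_singleton'.mp ha
    rw [map_mul, toLaurent_P_sub, mul_zero]

@[simp]
theorem emb_proj (f : AmbientRing n) : emb n q c (proj n q c f) = toLaurent n q c f := rfl

variable {q c}

/-- In normal form the monomials have pairwise distinct leading exponents, so the largest one cannot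
cancel. -/
theorem IsAdapted.exists_isLead {Γ : Type*} [AddCommGroup Γ] [LinearOrder Γ]
    [IsOrderedAddMonoid Γ] {ν : Expo n →+ Γ} (hν : IsAdapted ν) {b : CoordRing n q c}
    (hb : b ≠ 0) : ∃ m ∈ leadSet n, IsLead ν (emb n q c b) m := by
  classical
  obtain ⟨f, rfl⟩ := Ideal.Quotient.mkₐ_surjective ℂ (fiberIdeal n q c) b
  obtain ⟨g, hg, hgf⟩ := exists_normalForm q c f
  rw [← hgf] at hb ⊢
  have hg0 : g.support.Nonempty := by
    rw [Finset.nonempty_iff_ne_empty, Ne, support_eq_empty]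
    rintro rfl
    exact hb (map_zero _)
  obtain ⟨m, hm, hmax⟩ := Finset.exists_max_image g.support (fun m => ν (leadExpo m)) hg0
  refine ⟨leadExpo m, leadExpo_mem_leadSet, ?_⟩
  rw [emb_proj, g.as_sum, map_sum, ← Finset.add_sum_erase _ _ hm]
  refine (hν.isLead_toLaurent_monomial q c m (mem_support_iff.mp hm)).add ?_
  refine IsBelow.sum _ _ fun m' hm' => ?_
  rw [Finset.mem_erase] at hm'
  have hlead := hν.isLead_toLaurent_monomial q c m' (mem_support_iff.mp hm'.2)
  have hlt : ν (leadExpo m') < ν (leadExpo m) :=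
    lt_of_le_of_ne (hmax m' hm'.2) fun h =>
      hm'.1 (leadExpo_injOn (hg hm'.2) (hg hm) (hν.injective h))
  exact fun e he => (hlead.le he).trans_lt hlt

theorem IsAdapted.mem_leadSet {Γ : Type*} [AddCommGroup Γ] [LinearOrder Γ]
    [IsOrderedAddMonoid Γ] {ν : Expo n →+ Γ} (hν : IsAdapted ν) {b : CoordRing n q c}
    {m : Expo n} (h : IsLead ν (emb n q c b) m) : m ∈ leadSet n := by
  have hb : b ≠ 0 := by
    rintro rfl
    exact h.ne_zero (map_zero _)
  obtain ⟨m', hm', h'⟩ := hν.exists_isLead hb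
  rwa [h.unique h']

theorem emb_injective (hn : 1 ≤ n) : Function.Injective (emb n q c) := by
  rw [injective_iff_map_eq_zero]
  intro b hb
  by_contra hne
  obtain ⟨m, -, hm⟩ := (weightX_isAdapted (⟨0, hn⟩ : Fin n)).exists_isLead hne
  exact hm.ne_zero hb

theorem isDomain_coordRing (hn : 1 ≤ n) : IsDomain (CoordRing n q c) :=
  (emb_injective hn).isDomain

/-- The image of `B_{q,c}` in the Laurent polynomial ring is polynomial in `z`. -/
theorem emb_coeff_snd_nonneg (b : CoordRing n q c) {m : Expo n}
    (h : (emb n q c b).coeff m ≠ 0) : 0 ≤ m.2 := by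
  obtain ⟨f, rfl⟩ := Ideal.Quotient.mkₐ_surjective ℂ (fiberIdeal n q c) b
  rw [emb_proj] at h
  have hmono : ∀ (a : ℂ) (e : Expo n) {m : Expo n}, 0 ≤ e.2 → (a • mono e).coeff m ≠ 0 →
      0 ≤ m.2 := by
    intro a e m he hm
    by_cases hem : e = m
    · exact hem ▸ he
    · simp [mono, hem] at hm
  induction f using MvPolynomial.induction_on generalizing m with
  | C a =>
    refine hmono a 0 le_rfl ?_
    rwa [mono_zero, ← Algebra.algebraMap_eq_smul_one, ← (toLaurent n q c).commutes a]
  | add f g hf hg =>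
    by_cases h0 : (toLaurent n q c f).coeff m = 0
    · exact hg (by simpa [h0] using h)
    · exact hf h0
  | mul_X f x hf =>
    rw [map_mul] at h
    obtain ⟨a, b, ha, hb, rfl⟩ := exists_add_of_coeff_mul_ne_zero h
    refine add_nonneg (hf ha) ?_
    rcases x with i | j
    · have hb' : ((1 : ℂ) • mono (expX i)).coeff b ≠ 0 := by
        rw [one_smul, ← toLaurent_varX q c]
        exact hb
      exact hmono 1 (expX i) le_rfl hb'
    · fin_cases j
      · change (toLaurent n q c (varY n)).coeff b ≠ 0 at hb
        rw [toLaurent_varY, laurentY_eq] at hb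
        by_contra hneg
        refine hb ?_
        have hzero : ∀ (a : ℂ) (e : Expo n), 0 ≤ e.2 → (a • mono e).coeff b = 0 := by
          intro a e he
          by_contra hne
          exact hneg (hmono a e he hne)
        rw [← neg_one_smul ℂ (mono expY), AddMonoidAlgebra.coeff_add, AddMonoidAlgebra.coeff_sub,
          AddMonoidAlgebra.coeff_sum, Finsupp.add_apply, Finsupp.sub_apply, Finsupp.finsetSum_apply,
          hzero _ _ (by simp [expY]), hzero _ _ (by simp [expU]),
          Finset.sum_eq_zero fun j _ => hzero _ _ (by simp [expU, expZ])]
        simp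
      · have hb' : ((1 : ℂ) • mono expZ).coeff b ≠ 0 := by
          rw [one_smul, ← toLaurent_varZ q c]
          exact hb
        exact hmono 1 expZ zero_le_one hb'

/-- A Laurent polynomial without negative exponents is the image of an element of `B_{q,c}`. -/
theorem exists_emb_eq {v : Laurent n} (h1 : ∀ m i, v.coeff m ≠ 0 → 0 ≤ m.1 i)
    (h2 : ∀ m, v.coeff m ≠ 0 → 0 ≤ m.2) : ∃ b, emb n q c b = v := by
  change v ∈ (emb n q c).range
  rw [← AddMonoidAlgebra.sum_coeff_single v]
  refine Subalgebra.sum_mem _ fun m hm => ?_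
  rw [Finsupp.mem_support_iff] at hm
  have hs : AddMonoidAlgebra.single m (v.coeff m) = v.coeff m • mono m := by
    simp [mono, AddMonoidAlgebra.smul_single]
  rw [hs, expo_eq_sum m, mono_add, mono_sum]
  refine Subalgebra.smul_mem _
    (Subalgebra.mul_mem _ (Subalgebra.prod_mem _ fun i _ => ?_) ?_) _
  · obtain ⟨k, hk⟩ := Int.eq_ofNat_of_zero_le (h1 m i hm)
    rw [hk, natCast_zsmul, mono_nsmul]
    exact Subalgebra.pow_mem _ ((AlgHom.mem_range _).mpr ⟨proj n q c (varX n i), toLaurent_varX q c i⟩) k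
  · obtain ⟨k, hk⟩ := Int.eq_ofNat_of_zero_le (h2 m hm)
    rw [hk, natCast_zsmul, mono_nsmul]
    exact Subalgebra.pow_mem _ ((AlgHom.mem_range _).mpr ⟨proj n q c (varZ n), toLaurent_varZ q c⟩) k

theorem emb_ofBase_X (i : Fin n) : emb n q c (ofBase n q c (X i)) = mono (expX i) := by
  rw [← toLaurent_varX q c i, ← emb_proj]
  simp [ofBase, varX]

theorem emb_zClass : emb n q c (zClass n q c) = mono expZ := toLaurent_varZ q c

/-- A Laurent polynomial without negative exponents and not involving `z` comes from
`ℂ[x₁, …, xₙ]`. -/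
theorem exists_emb_ofBase_eq {v : Laurent n} (h1 : ∀ m i, v.coeff m ≠ 0 → 0 ≤ m.1 i)
    (h2 : ∀ m, v.coeff m ≠ 0 → m.2 = 0) : ∃ f, emb n q c (ofBase n q c f) = v := by
  change v ∈ ((emb n q c).comp (ofBase n q c)).range
  rw [← AddMonoidAlgebra.sum_coeff_single v]
  refine Subalgebra.sum_mem _ fun m hm => ?_
  rw [Finsupp.mem_support_iff] at hm
  have hs : AddMonoidAlgebra.single m (v.coeff m) = v.coeff m • mono m := by
    simp [mono, AddMonoidAlgebra.smul_single]
  rw [hs, expo_eq_sum m, h2 m hm, zero_smul, add_zero, mono_sum]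
  refine Subalgebra.smul_mem _ (Subalgebra.prod_mem _ fun i _ => ?_) _
  obtain ⟨k, hk⟩ := Int.eq_ofNat_of_zero_le (h1 m i hm)
  rw [hk, natCast_zsmul, mono_nsmul]
  exact Subalgebra.pow_mem _ ((AlgHom.mem_range _).mpr ⟨X i, emb_ofBase_X i⟩) k

theorem emb_ofBase_coeff (f : BaseRing n) {m : Expo n}
    (h : (emb n q c (ofBase n q c f)).coeff m ≠ 0) : m.2 = 0 := by
  induction f using MvPolynomial.induction_on generalizing m with
  | C a =>
    have : emb n q c (ofBase n q c (C a)) = a • mono 0 := by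
      rw [mono_zero, ← Algebra.algebraMap_eq_smul_one]
      exact ((emb n q c).comp (ofBase n q c)).commutes a
    rw [this] at h
    by_cases hem : 0 = m
    · rw [← hem]; rfl
    · simp [mono, hem] at h
  | add f g hf hg =>
    by_cases h0 : (emb n q c (ofBase n q c f)).coeff m = 0
    · exact hg (by simpa [h0] using h)
    · exact hf h0
  | mul_X f i hf =>
    rw [map_mul, map_mul, emb_ofBase_X] at h
    obtain ⟨a, b, ha, hb, rfl⟩ := exists_add_of_coeff_mul_ne_zero h
    rw [Prod.snd_add, hf ha, zero_add]
    by_cases hem : expX i = b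
    · rw [← hem]; rfl
    · simp [mono, hem] at hb

end

section

/-! ### Locally nilpotent derivations of a domain -/

section LocallyNilpotent

variable {B : Type*} [CommRing B] [Algebra ℂ B] {δ : Derivation ℂ B B}

/-- The top term of the Leibniz formula for iterates of a derivation. -/
theorem iterate_derivation_mul (δ : Derivation ℂ B B) (N : ℕ) :
    ∀ (k m : ℕ) (a b : B), k + m = N → δ^[k + 1] a = 0 → δ^[m + 1] b = 0 →
      ∃ C : ℕ, C ≠ 0 ∧ δ^[N] (a * b) = C * (δ^[k] a * δ^[m] b) := by
  induction N with
  | zero =>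
    intro k m a b h _ _
    obtain ⟨rfl, rfl⟩ : k = 0 ∧ m = 0 := by omega
    exact ⟨1, one_ne_zero, by simp⟩
  | succ N ih =>
    intro k m a b h ha hb
    rw [Function.iterate_succ_apply, Derivation.leibniz, smul_eq_mul, smul_eq_mul, mul_comm b,
      iterate_map_add]
    rcases k with _ | k
    · obtain rfl : m = N + 1 := by omega
      rw [zero_add, Function.iterate_one] at ha
      obtain ⟨C, hC, h1⟩ := ih 0 N a (δ b) (by omega) (by simpa using ha) hb
      refine ⟨C, hC, ?_⟩
      rw [ha, zero_mul, iterate_map_zero, add_zero, h1]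
      rfl
    · rcases m with _ | m
      · obtain rfl : k = N := by omega
        rw [zero_add, Function.iterate_one] at hb
        obtain ⟨C, hC, h1⟩ := ih k 0 (δ a) b (by omega) ha (by simpa using hb)
        refine ⟨C, hC, ?_⟩
        rw [hb, mul_zero, iterate_map_zero, zero_add, h1]
        rfl
      · obtain ⟨C, hC, h1⟩ := ih (k + 1) m a (δ b) (by omega) ha hb
        obtain ⟨C', hC', h2⟩ := ih k (m + 1) (δ a) b (by omega) ha hb
        refine ⟨C + C', by omega, ?_⟩
        rw [h1, h2]
        push_cast
        simp only [Function.iterate_succ_apply]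
        ring

theorem IsLocallyNilpotent.exists_index (hδ : IsLocallyNilpotent δ) {b : B} (hb : b ≠ 0) :
    ∃ k, δ^[k] b ≠ 0 ∧ δ^[k + 1] b = 0 := by
  classical
  have hex : ∃ k, δ^[k] b = 0 := by
    obtain ⟨k, -, hk⟩ := hδ b
    exact ⟨k, hk⟩
  obtain ⟨k, hk⟩ : ∃ k, Nat.find hex = k + 1 := by
    refine Nat.exists_eq_succ_of_ne_zero fun h0 => hb ?_
    simpa [h0] using Nat.find_spec hex
  exact ⟨k, Nat.find_min hex (by omega), hk ▸ Nat.find_spec hex⟩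

/-- A locally nilpotent derivation of a domain kills every element dividing its derivative. -/
theorem IsLocallyNilpotent.eq_zero_of_eq_mul [IsDomain B] (hδ : IsLocallyNilpotent δ) {a g : B}
    (h : δ a = a * g) : δ a = 0 := by
  by_contra hne
  have ha : a ≠ 0 := by
    rintro rfl
    exact hne (map_zero δ)
  have hg : g ≠ 0 := by
    rintro rfl
    exact hne (by rw [h, mul_zero])
  obtain ⟨k, hk, hk'⟩ := hδ.exists_index ha
  obtain ⟨m, hm, hm'⟩ := hδ.exists_index hg
  obtain ⟨C, hC, hmul⟩ := iterate_derivation_mul δ (k + m) k m a g rfl hk' hm'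
  -- The nilpotency index of `a * g` is `k + m`, whereas that of `δ a` is below `k`.
  have h0 : δ^[k + m] (a * g) = 0 := by
    rw [← h, ← Function.iterate_succ_apply, show (k + m).succ = m + (k + 1) by omega,
      Function.iterate_add_apply, hk', iterate_map_zero]
  rw [h0] at hmul
  have : CharZero B := charZero_of_injective_algebraMap (algebraMap ℂ B).injective
  exact mul_ne_zero (Nat.cast_ne_zero.mpr hC) (mul_ne_zero hk hm) hmul.symm

end LocallyNilpotent

/-! ### Derivations of the coordinate ring as logarithmic derivations -/

variable {n : ℕ} {q : Polynomial ℂ} {c : ℂ}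

theorem logDeriv_zero {M : Type*} [AddCommGroup M] (v : AddMonoidAlgebra ℂ M) :
    logDeriv 0 v = 0 := by
  simp [logDeriv_eq_sum]

/-- A derivation of `B_{q,c}` is the restriction of a derivation of the Laurent polynomial
ring. -/
theorem emb_derivation (δ : Derivation ℂ (CoordRing n q c) (CoordRing n q c))
    (Λ : Expo n →+ Laurent n)
    (hX : ∀ i, emb n q c (δ (proj n q c (varX n i))) = mono (expX i) * Λ (expX i))
    (hZ : emb n q c (δ (zClass n q c)) = mono expZ * Λ expZ) (b : CoordRing n q c) :
    emb n q c (δ b) = logDeriv Λ (emb n q c b) := by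
  -- With this module structure the difference `F` of the two sides is a derivation on the
  -- polynomial ring, so it suffices to check it on variables.
  let _ : Module (AmbientRing n) (Laurent n) := Module.compHom _ (toLaurent n q c).toRingHom
  have smul_def : ∀ (a : AmbientRing n) (v : Laurent n), a • v = toLaurent n q c a * v :=
    fun _ _ => rfl
  let F : Derivation ℂ (AmbientRing n) (Laurent n) := Derivation.mk'
    ((emb n q c).toLinearMap ∘ₗ δ.toLinearMap ∘ₗ (proj n q c).toLinearMap -
      (logDeriv Λ).toLinearMap ∘ₗ (toLaurent n q c).toLinearMap) <| by
    intro a b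
    have h1 : emb n q c (δ (proj n q c (a * b))) =
        toLaurent n q c a * emb n q c (δ (proj n q c b)) +
          toLaurent n q c b * emb n q c (δ (proj n q c a)) := by
      rw [map_mul, Derivation.leibniz, map_add, smul_eq_mul, smul_eq_mul, map_mul, map_mul,
        emb_proj, emb_proj]
    have h2 : logDeriv Λ (toLaurent n q c (a * b)) =
        toLaurent n q c a * logDeriv Λ (toLaurent n q c b) +
          toLaurent n q c b * logDeriv Λ (toLaurent n q c a) := by
      rw [map_mul, Derivation.leibniz, smul_eq_mul, smul_eq_mul]
    change emb n q c (δ (proj n q c (a * b))) - logDeriv Λ (toLaurent n q c (a * b)) =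
      toLaurent n q c a * (emb n q c (δ (proj n q c b)) - logDeriv Λ (toLaurent n q c b)) +
        toLaurent n q c b * (emb n q c (δ (proj n q c a)) - logDeriv Λ (toLaurent n q c a))
    rw [h1, h2]
    ring
  have F_apply : ∀ a, F a = emb n q c (δ (proj n q c a)) - logDeriv Λ (toLaurent n q c a) :=
    fun _ => rfl
  have FX : ∀ i, F (varX n i) = 0 := by
    intro i
    rw [F_apply, hX, toLaurent_varX, mono, logDeriv_single, sub_self]
  have FZ : F (varZ n) = 0 := by
    rw [F_apply, toLaurent_varZ, mono, logDeriv_single, sub_eq_zero]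
    exact hZ
  let A := Algebra.adjoin ℂ (Set.range (varX n) ∪ {varZ n})
  have FA : ∀ a ∈ A, F a = 0 := by
    refine Derivation.eqOn_adjoin (D1 := F) (D2 := 0) ?_
    rintro a (⟨i, rfl⟩ | rfl)
    · exact FX i
    · exact FZ
  have hA : ∀ a ∈ Set.range (varX n) ∪ {varZ n}, a ∈ A := fun a ha => Algebra.subset_adjoin ha
  have hxA : ∀ k, xPow n k ∈ A := fun k =>
    Subalgebra.prod_mem _ fun i _ => Subalgebra.pow_mem _ (hA _ (Or.inl ⟨i, rfl⟩)) k
  have hzA : varZ n ^ 2 ∈ A := Subalgebra.pow_mem _ (hA _ (Or.inr rfl)) 2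
  have hrA : varZ n ^ 2 + xPow n 1 * Polynomial.aeval (varZ n ^ 2) q - C c ∈ A := by
    rw [Polynomial.aeval_eq_sum_range]
    refine Subalgebra.sub_mem _ (Subalgebra.add_mem _ hzA (Subalgebra.mul_mem _ (hxA 1) ?_))
      (Subalgebra.algebraMap_mem _ c)
    exact Subalgebra.sum_mem _ fun j _ => Subalgebra.smul_mem _ (Subalgebra.pow_mem _ hzA j) _
  -- Applying `F` to the defining relation leaves `x^[2] F(y) = 0`, and the monomial `x^[2]` is not
  -- a zero divisor.
  have FY : F (varY n) = 0 := by
    have h0 : F (P n q - C c) = 0 := by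
      have hp : proj n q c (P n q - C c) = 0 :=
        Ideal.Quotient.eq_zero_iff_mem.mpr (Ideal.mem_span_singleton_self _)
      rw [F_apply, hp, toLaurent_P_sub, map_zero, map_zero, map_zero, sub_zero]
    have hP : P n q - C c = xPow n 2 * varY n +
        (varZ n ^ 2 + xPow n 1 * Polynomial.aeval (varZ n ^ 2) q - C c) := by
      rw [P]
      ring
    rw [hP, map_add, Derivation.leibniz, FA _ hrA, FA _ (hxA 2), smul_zero, add_zero, add_zero,
      smul_def, toLaurent_xPow] at h0
    exact (mul_eq_zero.mp h0).resolve_left (mono_ne_zero _)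
  have F0 : F = 0 := by
    refine MvPolynomial.derivation_ext fun x => ?_
    rcases x with i | j
    · exact FX i
    · fin_cases j
      · exact FY
      · exact FZ
  obtain ⟨a, rfl⟩ := Ideal.Quotient.mkₐ_surjective ℂ (fiberIdeal n q c) b
  rw [← sub_eq_zero]
  exact DFunLike.congr_fun F0 a

/-- The logarithmic coefficients of a derivation of `B_{q,c}`. -/
def logCoeff (δ : Derivation ℂ (CoordRing n q c) (CoordRing n q c)) : Expo n →+ Laurent n :=
  AddMonoidHom.mk' (fun m =>
    ∑ i, m.1 i • (mono (-expX i) * emb n q c (δ (proj n q c (varX n i)))) +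
      m.2 • (mono (-expZ) * emb n q c (δ (zClass n q c)))) fun a b => by
    simp only [Prod.fst_add, Prod.snd_add, Pi.add_apply, add_smul, Finset.sum_add_distrib]
    abel

theorem logCoeff_expX (δ : Derivation ℂ (CoordRing n q c) (CoordRing n q c)) (i : Fin n) :
    logCoeff δ (expX i) = mono (-expX i) * emb n q c (δ (proj n q c (varX n i))) := by
  simp only [logCoeff, AddMonoidHom.mk'_apply, expX, zero_smul, add_zero]
  rw [Finset.sum_eq_single i (fun j _ hj => by rw [Pi.single_eq_of_ne hj, zero_smul])
    (fun h => absurd (Finset.mem_univ i) h), Pi.single_eq_same, one_smul]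

theorem logCoeff_expZ (δ : Derivation ℂ (CoordRing n q c) (CoordRing n q c)) :
    logCoeff δ expZ = mono (-expZ) * emb n q c (δ (zClass n q c)) := by
  simp [logCoeff, expZ]

theorem emb_varX (δ : Derivation ℂ (CoordRing n q c) (CoordRing n q c)) (i : Fin n) :
    emb n q c (δ (proj n q c (varX n i))) = mono (expX i) * logCoeff δ (expX i) := by
  rw [logCoeff_expX, ← mul_assoc, mono_mul_neg, one_mul]

theorem emb_zClass_derivation (δ : Derivation ℂ (CoordRing n q c) (CoordRing n q c)) :
    emb n q c (δ (zClass n q c)) = mono expZ * logCoeff δ expZ := by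
  rw [logCoeff_expZ, ← mul_assoc, mono_mul_neg, one_mul]

theorem emb_eq_logDeriv (δ : Derivation ℂ (CoordRing n q c) (CoordRing n q c))
    (b : CoordRing n q c) : emb n q c (δ b) = logDeriv (logCoeff δ) (emb n q c b) :=
  emb_derivation δ _ (emb_varX δ) (emb_zClass_derivation δ) b

theorem emb_iterate (δ : Derivation ℂ (CoordRing n q c) (CoordRing n q c)) (k : ℕ)
    (b : CoordRing n q c) :
    emb n q c (δ^[k] b) = (logDeriv (logCoeff δ))^[k] (emb n q c b) := by
  induction k with
  | zero => rfl
  | succ k ih => rw [Function.iterate_succ_apply', Function.iterate_succ_apply', emb_eq_logDeriv, ih]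

theorem logCoeff_ne_zero (hn : 1 ≤ n) {δ : Derivation ℂ (CoordRing n q c) (CoordRing n q c)}
    (hδ : δ ≠ 0) : logCoeff δ ≠ 0 := by
  intro h
  refine hδ (Derivation.ext fun b => emb_injective hn ?_)
  rw [emb_eq_logDeriv, h, logDeriv_zero, Derivation.zero_apply, map_zero]

/-- A nonzero logarithmic derivation has a dominant exponent. -/
theorem exists_dominant {Γ : Type*} [AddCommGroup Γ] [LinearOrder Γ] {ν : Expo n →+ Γ}
    (hν : Function.Injective ν) {Λ : Expo n →+ Laurent n} (hΛ : Λ ≠ 0) :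
    ∃ d, (∃ m, (Λ m).coeff d ≠ 0) ∧ ∀ m e, (Λ m).coeff e ≠ 0 → e ≠ d → ν e < ν d := by
  classical
  -- By additivity, every `Λ m` is supported in the union of the supports at the basis exponents, so
  -- a maximum exists.
  let T : Finset (Expo n) :=
    (Finset.univ.biUnion fun i => (Λ (expX i)).coeff.support) ∪ (Λ expZ).coeff.support
  have hT : ∀ m e, (Λ m).coeff e ≠ 0 → e ∈ T := by
    intro m e h
    by_contra hcon
    simp only [T, Finset.mem_union, Finset.mem_biUnion, Finset.mem_univ, true_and,
      Finsupp.mem_support_iff, not_or, not_exists, not_not] at hcon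
    refine h ?_
    rw [addMonoidHom_eq_sum, AddMonoidAlgebra.coeff_add, AddMonoidAlgebra.coeff_sum,
      Finsupp.add_apply, Finsupp.finsetSum_apply]
    simp only [AddMonoidAlgebra.coeff_smul, Finsupp.smul_apply, hcon.1, hcon.2, smul_zero,
      Finset.sum_const_zero, add_zero]
  have hT' : ∀ e ∈ T, ∃ m, (Λ m).coeff e ≠ 0 := by
    intro e he
    simp only [T, Finset.mem_union, Finset.mem_biUnion, Finset.mem_univ, true_and,
      Finsupp.mem_support_iff] at he
    rcases he with ⟨i, hi⟩ | he
    · exact ⟨_, hi⟩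
    · exact ⟨_, he⟩
  have hne : T.Nonempty := by
    obtain ⟨m, hm⟩ : ∃ m, Λ m ≠ 0 := by
      by_contra! hcon
      exact hΛ (AddMonoidHom.ext hcon)
    obtain ⟨e, he⟩ : ∃ e, (Λ m).coeff e ≠ 0 := by
      by_contra! hcon
      exact hm (AddMonoidAlgebra.coeff_eq_zero.mp (Finsupp.ext hcon))
    exact ⟨e, hT m e he⟩
  obtain ⟨d, hd, hmax⟩ := Finset.exists_max_image T ν hne
  exact ⟨d, hT' d hd, fun m e he hed =>
    lt_of_le_of_ne (hmax e (hT m e he)) fun h => hed (hν h)⟩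

/-- The logarithmic coefficients of a locally nilpotent derivation are divisible by `x^[2]`. -/
theorem two_le_of_logCoeff (δ : Derivation ℂ (CoordRing n q c) (CoordRing n q c))
    (hδ : IsLocallyNilpotent δ) {m e : Expo n} (he : (logCoeff δ m).coeff e ≠ 0) (i : Fin n) :
    2 ≤ e.1 i := by
  have hν := weightX_isAdapted i
  have hΛ : logCoeff δ ≠ 0 := by
    intro h
    simp [h] at he
  obtain ⟨d, ⟨m₀, hm₀⟩, hd⟩ := exists_dominant hν.injective hΛ
  have hlead : ∀ s : Expo n, ((∃ i, s = expX i) ∨ s = expZ ∨ s = expY) →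
      ∃ b, IsLead (weightX i) (emb n q c b) s := by
    rintro s (⟨j, rfl⟩ | rfl | rfl)
    · exact ⟨proj n q c (varX n j), by
        rw [emb_proj, toLaurent_varX]; exact isLead_mono _ _⟩
    · exact ⟨proj n q c (varZ n), by
        rw [emb_proj, toLaurent_varZ]; exact isLead_mono _ _⟩
    · exact ⟨proj n q c (varY n), by
        rw [emb_proj, toLaurent_varY]; exact hν.isLead_laurentY q c⟩
  let l : Expo n →+ ℂ := AddMonoidHom.mk' (fun m => (logCoeff δ m).coeff d) fun a b => by
    rw [map_add, AddMonoidAlgebra.coeff_add, Finsupp.add_apply]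
  have hd2 : ∀ i, 2 ≤ d.1 i := by
    refine shift_of_locallyNilpotent l (fun h => hm₀ (DFunLike.congr_fun h m₀)) d ?_ ?_
    · intro s hs hls
      obtain ⟨b, hb⟩ := hlead s hs
      have := hb.logDeriv hd hls
      rw [← emb_eq_logDeriv] at this
      exact hν.mem_leadSet this
    · intro s hs
      obtain ⟨b, hb⟩ := hlead s hs
      obtain ⟨k, -, hk⟩ := hδ b
      refine hb.iterate_logDeriv hd (k := k) ?_
      rw [← emb_iterate, hk, map_zero]
  -- `weightX i` compares `-aᵢ` first, so the dominant `d` has the smallest `i`-th exponent.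
  by_cases hed : e = d
  · exact hed ▸ hd2 i
  · exact (hd2 i).trans (weightX_le (hd m e he hed).le)

theorem snd_add_logCoeff_expX_nonneg (δ : Derivation ℂ (CoordRing n q c) (CoordRing n q c))
    {i : Fin n} {e : Expo n} (he : (logCoeff δ (expX i)).coeff e ≠ 0) : 0 ≤ e.2 := by
  have h : (emb n q c (δ (proj n q c (varX n i)))).coeff (expX i + e) ≠ 0 := by
    rwa [emb_varX, coeff_mono_mul, neg_add_cancel_left]
  simpa [expX] using emb_coeff_snd_nonneg _ h

theorem neg_one_le_logCoeff_expZ (δ : Derivation ℂ (CoordRing n q c) (CoordRing n q c))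
    {e : Expo n} (he : (logCoeff δ expZ).coeff e ≠ 0) : -1 ≤ e.2 := by
  have h : (emb n q c (δ (zClass n q c))).coeff (expZ + e) ≠ 0 := by
    rwa [emb_zClass_derivation, coeff_mono_mul, neg_add_cancel_left]
  have := emb_coeff_snd_nonneg _ h
  simp only [expZ, Prod.snd_add] at this
  omega

/-- Every locally nilpotent derivation of `B_{q,c}` kills the `xᵢ`. -/
theorem IsLocallyNilpotent.logCoeff_expX (hn : 1 ≤ n)
    {δ : Derivation ℂ (CoordRing n q c) (CoordRing n q c)} (hδ : IsLocallyNilpotent δ)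
    (i : Fin n) : logCoeff δ (expX i) = 0 := by
  obtain ⟨g, hg⟩ : ∃ g, emb n q c g = logCoeff δ (expX i) :=
    exists_emb_eq (fun e j he => zero_le_two.trans (two_le_of_logCoeff δ hδ he j))
      (fun e he => snd_add_logCoeff_expX_nonneg δ he)
  have h : δ (proj n q c (varX n i)) = proj n q c (varX n i) * g := by
    refine emb_injective hn ?_
    rw [emb_varX, map_mul, hg, emb_proj, toLaurent_varX]
  have := isDomain_coordRing (q := q) (c := c) hn
  rw [LNDHypersurface.logCoeff_expX, hδ.eq_zero_of_eq_mul h, map_zero, mul_zero]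

theorem IsLocallyNilpotent.logCoeff_eq (hn : 1 ≤ n)
    {δ : Derivation ℂ (CoordRing n q c) (CoordRing n q c)} (hδ : IsLocallyNilpotent δ)
    (m : Expo n) : logCoeff δ m = m.2 • logCoeff δ expZ := by
  rw [addMonoidHom_eq_sum]
  simp [hδ.logCoeff_expX hn]

/-- Nilpotency at `z` gives `1 + j * d.2 = 0` for the exponent `d` dominant in `weightZ`, so `d.2`
is negative and bounds all `z`-exponents above. They are at least -1 because `δ z` is polynomial in
`z`. -/
theorem IsLocallyNilpotent.snd_eq_neg_one (hn : 1 ≤ n)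
    {δ : Derivation ℂ (CoordRing n q c) (CoordRing n q c)} (hδ : IsLocallyNilpotent δ)
    {e : Expo n} (he : (logCoeff δ expZ).coeff e ≠ 0) : e.2 = -1 := by
  have hΛ : logCoeff δ ≠ 0 := by
    intro h
    simp [h] at he
  obtain ⟨d, ⟨m₀, hm₀⟩, hd⟩ := exists_dominant weightZ_injective hΛ
  have hcoeff : ∀ m, (logCoeff δ m).coeff d = m.2 * (logCoeff δ expZ).coeff d := by
    intro m
    rw [hδ.logCoeff_eq hn, AddMonoidAlgebra.coeff_smul, Finsupp.smul_apply, zsmul_eq_mul]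
  have hZd : (logCoeff δ expZ).coeff d ≠ 0 := by
    rw [hcoeff] at hm₀
    exact right_ne_zero_of_mul hm₀
  obtain ⟨k, -, hk⟩ := hδ (zClass n q c)
  have hlead : IsLead weightZ (emb n q c (zClass n q c)) expZ := by
    rw [emb_zClass]
    exact isLead_mono _ _
  obtain ⟨j, hj⟩ := hlead.iterate_logDeriv hd (k := k) (by rw [← emb_iterate, hk, map_zero])
  rw [hcoeff] at hj
  have hj' : (1 : ℤ) + j * d.2 = 0 := by
    have := (mul_eq_zero.mp hj).resolve_right hZd
    simpa [expZ] using Int.cast_eq_zero.mp this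
  have hd0 : d.2 < 0 := by
    by_contra! hcon
    have := mul_nonneg (Int.natCast_nonneg j) hcon
    omega
  have hle : e.2 ≤ d.2 := by
    by_cases hed : e = d
    · rw [hed]
    · exact weightZ_le (hd _ e he hed).le
  have := neg_one_le_logCoeff_expZ δ he
  omega

theorem delta_varX (i : Fin n) : delta n q c (proj n q c (varX n i)) = 0 := by
  rw [delta_proj, ambientDelta_varX, map_zero]

theorem emb_delta_zClass : emb n q c (delta n q c (zClass n q c)) = mono (2 • expU) := by
  rw [zClass, delta_proj, ambientDelta_varZ, emb_proj, toLaurent_xPow]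

theorem IsLocallyNilpotent.exists_logCoeff_expZ_eq (hn : 1 ≤ n)
    {δ : Derivation ℂ (CoordRing n q c) (CoordRing n q c)} (hδ : IsLocallyNilpotent δ) :
    ∃ h : BaseRing n, logCoeff δ expZ = mono (2 • expU - expZ) * emb n q c (ofBase n q c h) := by
  obtain ⟨h, hh⟩ : ∃ h, emb n q c (ofBase n q c h) =
      mono (-(2 • expU - expZ)) * logCoeff δ expZ := by
    refine exists_emb_ofBase_eq (fun e i he => ?_) (fun e he => ?_)
    · rw [coeff_mono_mul] at he
      have := two_le_of_logCoeff δ hδ he i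
      simp [expU, expZ] at this
      exact this
    · rw [coeff_mono_mul] at he
      have := hδ.snd_eq_neg_one hn he
      simp [expU, expZ] at this
      exact this
  exact ⟨h, by rw [hh, ← mul_assoc, mono_mul_neg, one_mul]⟩

theorem IsLocallyNilpotent.exists_eq_smul_delta (hn : 1 ≤ n)
    {δ : Derivation ℂ (CoordRing n q c) (CoordRing n q c)} (hδ : IsLocallyNilpotent δ) :
    ∃ h : BaseRing n, δ = ofBase n q c h • delta n q c := by
  obtain ⟨h, hh⟩ := hδ.exists_logCoeff_expZ_eq hn
  refine ⟨h, Derivation.ext fun b => emb_injective hn ?_⟩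
  rw [emb_eq_logDeriv]
  refine (emb_derivation _ _ (fun i => ?_) ?_ b).symm
  · rw [hδ.logCoeff_expX hn, mul_zero, Derivation.smul_apply, delta_varX, smul_zero, map_zero]
  · rw [hh, ← mul_assoc, ← mono_add, add_sub_cancel, Derivation.smul_apply, smul_eq_mul, map_mul,
      emb_delta_zClass, mul_comm]

/-! ### Kernels by comparison with the Euler derivation -/

/-- The exponents of the Euler derivation `z ∂/∂z`. -/
def eulerExpo (n : ℕ) : Expo n →+ Laurent n :=
  (zmultiplesHom _ 1).comp (AddMonoidHom.snd _ _)

theorem coeff_euler (v : Laurent n) (e : Expo n) :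
    (logDeriv (eulerExpo n) v).coeff e = e.2 * v.coeff e := by
  induction v using AddMonoidAlgebra.induction_linear with
  | zero => simp
  | add f g hf hg => simp [hf, hg, mul_add]
  | single m a =>
    have : AddMonoidAlgebra.single m a * eulerExpo n m = m.2 • AddMonoidAlgebra.single m a := by
      rw [eulerExpo, AddMonoidHom.comp_apply, AddMonoidHom.coe_snd, zmultiplesHom_apply,
        mul_smul_comm, mul_one]
    rw [logDeriv_single, this, AddMonoidAlgebra.coeff_smul, Finsupp.smul_apply, zsmul_eq_mul]
    by_cases h : m = e
    · rw [h]
    · simp [h]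

theorem logDeriv_eq_mul_euler {Λ : Expo n →+ Laurent n} {w : Laurent n}
    (h : ∀ m, Λ m = m.2 • w) (v : Laurent n) :
    logDeriv Λ v = w * logDeriv (eulerExpo n) v := by
  rw [logDeriv_eq_sum, logDeriv_eq_sum, Finset.mul_sum]
  refine Finset.sum_congr rfl fun m _ => ?_
  rw [h, eulerExpo, AddMonoidHom.comp_apply, AddMonoidHom.coe_snd, zmultiplesHom_apply,
    zsmul_eq_mul, zsmul_eq_mul]
  ring

/-- For `z`-exponent 0 or 1 the bound in `leadSet` is `0 ≤ m.1 i`, and the leading exponent for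
`weightX i` has the least `i`-th exponent. -/
theorem fst_nonneg_of_snd_lt_two {b : CoordRing n q c}
    (h : ∀ m, (emb n q c b).coeff m ≠ 0 → m.2 < 2) {m : Expo n}
    (hm : (emb n q c b).coeff m ≠ 0) (i : Fin n) : 0 ≤ m.1 i := by
  have hν := weightX_isAdapted i
  have hb : emb n q c b ≠ 0 := by
    intro h0
    simp [h0] at hm
  obtain ⟨e, he⟩ := exists_isLead_of_ne_zero hν.injective hb
  have hS := hν.mem_leadSet he
  have h0 := hS.1
  have h1 := hS.2 i
  have h2 := h e he.1
  have h3 := weightX_le (he.le hm)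
  omega

section Kernel

variable {δ : Derivation ℂ (CoordRing n q c) (CoordRing n q c)}

theorem IsLocallyNilpotent.emb_eq_mul_euler (hn : 1 ≤ n) (hδ : IsLocallyNilpotent δ)
    (b : CoordRing n q c) :
    emb n q c (δ b) = logCoeff δ expZ * logDeriv (eulerExpo n) (emb n q c b) := by
  rw [emb_eq_logDeriv, logDeriv_eq_mul_euler (hδ.logCoeff_eq hn)]

theorem IsLocallyNilpotent.logCoeff_expZ_ne_zero (hn : 1 ≤ n) (hδ : IsLocallyNilpotent δ)
    (hδ0 : δ ≠ 0) : logCoeff δ expZ ≠ 0 := by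
  intro h
  refine logCoeff_ne_zero hn hδ0 (AddMonoidHom.ext fun m => ?_)
  rw [hδ.logCoeff_eq hn, h, smul_zero, AddMonoidHom.zero_apply]

theorem IsLocallyNilpotent.apply_eq_zero_iff (hn : 1 ≤ n) (hδ : IsLocallyNilpotent δ)
    (hδ0 : δ ≠ 0) (b : CoordRing n q c) :
    δ b = 0 ↔ logDeriv (eulerExpo n) (emb n q c b) = 0 := by
  rw [← map_eq_zero_iff _ (emb_injective hn), hδ.emb_eq_mul_euler hn, mul_eq_zero,
    or_iff_right (hδ.logCoeff_expZ_ne_zero hn hδ0)]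

theorem euler_eq_zero_iff (v : Laurent n) :
    logDeriv (eulerExpo n) v = 0 ↔ ∀ m, v.coeff m ≠ 0 → m.2 = 0 := by
  rw [← AddMonoidAlgebra.coeff_eq_zero, Finsupp.ext_iff]
  refine forall_congr' fun m => ?_
  rw [coeff_euler, Finsupp.zero_apply, mul_eq_zero, Int.cast_eq_zero]
  tauto

theorem IsLocallyNilpotent.ker_eq (hn : 1 ≤ n) (hδ : IsLocallyNilpotent δ) (hδ0 : δ ≠ 0) :
    {b : CoordRing n q c | δ b = 0} = Set.range (ofBase n q c) := by
  ext b
  rw [Set.mem_ofPred_eq, hδ.apply_eq_zero_iff hn hδ0, euler_eq_zero_iff]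
  constructor
  · intro h
    obtain ⟨f, hf⟩ := exists_emb_ofBase_eq (q := q) (c := c)
      (fun m i hm => fst_nonneg_of_snd_lt_two (fun m hm => by rw [h m hm]; norm_num) hm i) h
    exact ⟨f, emb_injective hn hf⟩
  · rintro ⟨f, rfl⟩ m hm
    exact emb_ofBase_coeff f hm

theorem IsLocallyNilpotent.ker_sq_eq (hn : 1 ≤ n) (hδ : IsLocallyNilpotent δ) (hδ0 : δ ≠ 0) :
    {b : CoordRing n q c | δ (δ b) = 0} =
      {b | ∃ f g : BaseRing n, b = ofBase n q c f * zClass n q c + ofBase n q c g} := by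
  -- With `w = logCoeff δ expZ` of `z`-degree -1, `E(w E b) = w (E² b - E b)`; so `δ² b = 0` means
  -- `E² b = E b`, and each `z`-exponent `k` satisfies `k² = k`.
  have hZ : logDeriv (eulerExpo n) (logCoeff δ expZ) = -logCoeff δ expZ := by
    refine AddMonoidAlgebra.ext (Finsupp.ext fun e => ?_)
    rw [coeff_euler, AddMonoidAlgebra.coeff_neg, Finsupp.neg_apply]
    by_cases he : (logCoeff δ expZ).coeff e = 0
    · simp [he]
    · simp [hδ.snd_eq_neg_one hn he]
  have key : ∀ b, δ (δ b) = 0 ↔ logDeriv (eulerExpo n) (logDeriv (eulerExpo n) (emb n q c b)) =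
      logDeriv (eulerExpo n) (emb n q c b) := by
    intro b
    rw [hδ.apply_eq_zero_iff hn hδ0, hδ.emb_eq_mul_euler hn, Derivation.leibniz, hZ, smul_eq_mul,
      smul_eq_mul, mul_neg, ← sub_eq_add_neg, sub_eq_zero, mul_comm (logDeriv _ (emb n q c b)),
      mul_right_inj' (hδ.logCoeff_expZ_ne_zero hn hδ0)]
  have hker : ∀ f, δ (ofBase n q c f) = 0 := fun f =>
    (Set.ext_iff.mp (hδ.ker_eq hn hδ0) _).mpr ⟨f, rfl⟩
  ext b
  constructor
  · intro hb
    have hb' := (key b).mp hb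
    have hsnd : ∀ m, (emb n q c b).coeff m ≠ 0 → m.2 = 0 ∨ m.2 = 1 := by
      intro m hm
      have h := congrArg (fun v : Laurent n => v.coeff m) hb'
      simp only [coeff_euler] at h
      by_cases h0 : m.2 = 0
      · exact Or.inl h0
      · right
        have h0' : (m.2 : ℂ) ≠ 0 := Int.cast_ne_zero.mpr h0
        have := mul_right_cancel₀ (mul_ne_zero h0' hm) (h.trans (one_mul _).symm)
        exact_mod_cast this
    have hfst : ∀ m i, (emb n q c b).coeff m ≠ 0 → 0 ≤ m.1 i := fun m i hm =>
      fst_nonneg_of_snd_lt_two (fun m hm => by have := hsnd m hm; omega) hm i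
    -- In `z`-degrees 0 and 1, `E` projects onto the degree 1 part: thus `f = z⁻¹ E b` and `g = b -
    -- E b`.
    obtain ⟨f, hf⟩ : ∃ f, emb n q c (ofBase n q c f) =
        mono (-expZ) * logDeriv (eulerExpo n) (emb n q c b) := by
      refine exists_emb_ofBase_eq (fun m i hm => ?_) (fun m hm => ?_)
      · rw [coeff_mono_mul, coeff_euler] at hm
        simpa [expZ] using hfst _ i (right_ne_zero_of_mul hm)
      · rw [coeff_mono_mul, coeff_euler] at hm
        have h1 := hsnd _ (right_ne_zero_of_mul hm)
        have h2 := Int.cast_ne_zero.mp (left_ne_zero_of_mul hm)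
        simp only [expZ, Prod.snd_add, Prod.snd_neg] at h1 h2
        omega
    have hcoeff : ∀ m, (emb n q c b - logDeriv (eulerExpo n) (emb n q c b)).coeff m =
        (1 - m.2) * (emb n q c b).coeff m := by
      intro m
      rw [AddMonoidAlgebra.coeff_sub, Finsupp.sub_apply, coeff_euler]
      ring
    obtain ⟨g, hg⟩ : ∃ g, emb n q c (ofBase n q c g) =
        emb n q c b - logDeriv (eulerExpo n) (emb n q c b) := by
      refine exists_emb_ofBase_eq (fun m i hm => ?_) (fun m hm => ?_)
      · rw [hcoeff] at hm
        exact hfst m i (right_ne_zero_of_mul hm)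
      · rw [hcoeff] at hm
        refine (hsnd m (right_ne_zero_of_mul hm)).resolve_right fun h1 => ?_
        simp [h1] at hm
    refine ⟨f, g, emb_injective hn ?_⟩
    rw [map_add, map_mul, hf, hg, emb_zClass, mul_right_comm, mono_neg_mul, one_mul,
      add_sub_cancel]
  · rintro ⟨f, g, rfl⟩
    have hz : δ (δ (zClass n q c)) = 0 := by
      rw [key, emb_zClass]
      have : logDeriv (eulerExpo n) (mono expZ) = mono expZ := by
        refine AddMonoidAlgebra.ext (Finsupp.ext fun e => ?_)
        rw [coeff_euler]
        by_cases he : expZ = e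
        · rw [← he]
          simp [expZ]
        · simp [mono, he]
      rw [this, this]
    rw [Set.mem_ofPred_eq, map_add, hker, add_zero, Derivation.leibniz, hker, smul_zero, add_zero,
      smul_eq_mul, Derivation.leibniz, hz, hker, smul_zero, smul_zero, add_zero]

end Kernel

/-! ### Local nilpotency of `Δ` -/

theorem isLocallyNilpotent_delta (n : ℕ) (hn : 1 ≤ n) (q : Polynomial ℂ) (c : ℂ) :
    IsLocallyNilpotent (delta n q c) := by
  have hX : ∀ i, logCoeff (delta n q c) (expX i) = 0 := by
    intro i
    rw [logCoeff_expX, delta_varX, map_zero, mul_zero]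
  have hZ : logCoeff (delta n q c) expZ = mono (-expZ + 2 • expU) := by
    rw [logCoeff_expZ, emb_delta_zClass, mono_add]
  have hΛ : ∀ m, logCoeff (delta n q c) m = m.2 • mono (-expZ + 2 • expU) := by
    intro m
    rw [addMonoidHom_eq_sum, hZ]
    simp [hX]
  -- Each application lowers `z`-exponents by one and kills the terms of exponent 0, so
  -- nonnegativity of the exponents persists.
  have key : ∀ (N : ℕ) (v : Laurent n), (∀ m, v.coeff m ≠ 0 → 0 ≤ m.2 ∧ m.2 < N) →
      (logDeriv (logCoeff (delta n q c)))^[N] v = 0 := by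
    intro N
    induction N with
    | zero =>
      intro v hv
      refine AddMonoidAlgebra.coeff_eq_zero.mp (Finsupp.ext fun m => ?_)
      by_contra hm
      have := hv m hm
      omega
    | succ N ih =>
      intro v hv
      rw [Function.iterate_succ_apply]
      refine ih _ fun m hm => ?_
      rw [logDeriv_eq_mul_euler hΛ, coeff_mono_mul, coeff_euler] at hm
      have h1 := hv _ (right_ne_zero_of_mul hm)
      have h2 := Int.cast_ne_zero.mp (left_ne_zero_of_mul hm)
      simp [expZ, expU] at h1 h2
      omega
  intro b
  let N := (emb n q c b).coeff.support.sup (fun m => m.2.toNat)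
  refine ⟨N + 1, by omega, emb_injective hn ?_⟩
  rw [emb_iterate, map_zero]
  refine key _ _ fun m hm => ⟨emb_coeff_snd_nonneg b hm, ?_⟩
  have : m.2.toNat ≤ N := Finset.le_sup (f := fun m : Expo n => m.2.toNat)
    (Finsupp.mem_support_iff.mpr hm)
  omega

end

end LNDHypersurface

end

open LNDHypersurface
theorem mainTheorem4 (n : ℕ) (hn : 1 ≤ n) (q : Polynomial ℂ) (c : ℂ) :
    IsLocallyNilpotent (delta n q c) ∧
    ∀ δ : Derivation ℂ (CoordRing n q c) (CoordRing n q c), δ ≠ 0 → IsLocallyNilpotent δ →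
      {b : CoordRing n q c | δ b = 0} = Set.range (ofBase n q c) ∧
      {b : CoordRing n q c | δ (δ b) = 0} =
        {b | ∃ f g : BaseRing n, b = ofBase n q c f * zClass n q c + ofBase n q c g} ∧
      ∃ h : BaseRing n, δ = ofBase n q c h • delta n q c :=
  ⟨isLocallyNilpotent_delta n hn q c, fun _ h0 hδ =>
    ⟨hδ.ker_eq hn h0, hδ.ker_sq_eq hn h0, hδ.exists_eq_smul_delta hn⟩⟩
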